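/- **Theorem 3.5.** Let $n\ge 0$, $0<s\le 1$, $1\le p<\infty$, $\frac1p+\frac1{p'}=1$, let $(Y,\nu)$ be a measure space, and put $H=L^2(Y,\nu)$ (complex-valued functions). Let $\mathbb{T}^n=(\mathbb{R}/\mathbb{Z})^n$ with normalised Haar measure $d\xi$, let $L^p(\mathbb{Z}^n,H)$ be taken with respect to counting measure, and let $a:\mathbb{Z}^n\times\mathbb{T}^n\to\mathcal{L}(H)$ be an operator-valued symbol such that $\xi\mapsto a(x,\xi)v$ is Bochner integrable on $\mathbb{T}^n$ for all $x\in\mathbb{Z}^n$, $v\in H$. For finitely supported $f:\mathbb{Z}^n\to H$ set $$\mathcal{F}_{\mathbb{Z}^n}f(\xi)=\sum_{x\in\mathbb{Z}^n}e^{-2\pi i x\cdot\xi}f(x),\qquad \mathfrak{t}_af(x)=\int_{\mathbb{T}^n}e^{2\pi i x\cdot\xi}a(x,\xi)\,\mathcal{F}_{\mathbb{Z}^n}f(\xi)\,d\xi .$$ A bounded operator $T$ on a Banach space $E$ is $s$-nuclear if there are $\varphi_k\in E'$, $u_k\in E$ with $\sum_k\|\varphi_k\|^s\|u_k\|^s<\infty$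 and $Tf=\sum_k\varphi_k(f)u_k$ for all $f\in E$; we say that $\mathfrak{t}_a$ is $s$-nuclear on $L^p(\mathbb{Z}^n,H)$ if it extends from the finitely supported functions to an $s$-nuclear operator on $L^p(\mathbb{Z}^n,H)$. For $h,u,v\in H$ write $(h\otimes u)v=\big(\int_Y u\,v\,d\nu\big)h$. 1. $\mathfrak{t}_a$ is $s$-nuclear on $L^p(\mathbb{Z}^n,H)$ if and only if there are sequences $(h_k)$ in $L^{p}(\mathbb{Z}^n,H)$ and $(g_k)$ in $L^{p'}(\mathbb{Z}^n,H)$ with $\sum_k\|h_k\|^s_{L^p}\|g_k\|^s_{L^{p'}}<\infty$ such that, for all $x\in\mathbb{Z}^n$ and $v\in H$, $$a(x,\xi)v=e^{-2\pi i x\cdot\xi}\Big(\sum_k h_k(x)\otimes\mathcal{F}_{\mathbb{Z}^n}g_k(-\xi)\Big)v \qquad (*)$$ as $H$-valued distributions in $\xi$. Here the Fourier transform of a bounded $g:\mathbb{Z}^n\to H$ is given by $\langle\mathcal{F}_{\mathbb{Z}^n}g,\psi\rangle=\sum_{y\in\mathbb{Z}^n}\big(\int_{\mathbb{T}^n}e^{-2\pi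 i y\cdot\xi}\psi(\xi)\,d\xi\big)g(y)$, and $(*)$ means that for every test function $\varphi$ in the Wiener algebra $A(\mathbb{T}^n)$ of continuous functions with absolutely summable Fourier coefficients (in particular, for every smooth $\varphi$) $$\int_{\mathbb{T}^n}\varphi(\xi)\,a(x,\xi)v\,d\xi=\sum_k\big(h_k(x)\otimes\langle\mathcal{F}_{\mathbb{Z}^n}g_k,\varphi_x\rangle\big)v,\qquad \varphi_x(\xi)=e^{2\pi i x\cdot\xi}\varphi(-\xi),$$ with unconditional convergence in the norm of $H$. 2. If $p\ge 2$ and $H$ is separable, then $\mathfrak{t}_a$ is $s$-nuclear on $L^p(\mathbb{Z}^n,H)$ if and only if there are sequences $(h_k)$ and $(g_k)$ in the same spaces, with the same summability, such that for almost every $\xi\in\mathbb{T}^n$ the identity $(*)$ holds for all $x\in\mathbb{Z}^n$ and $v\in H$, with unconditional convergence in the norm of $H$. Here $\mathcal{F}_{\mathbb{Z}^n}g_k\in L^2(\mathbb{T}^n,H)$ is the Fourier series $\sum_{y}e^{-2\pi i y\cdot\xi}g_k(y)$ summed in $L^2(\mathbb{T}^n,H)$ (note $L^{p'}(\mathbb{Z}^n,H)\subset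 L^2(\mathbb{Z}^n,H)$). -/

import Mathlib

open MeasureTheory
open scoped ENNReal

noncomputable section

/-- The normalised Haar (Lebesgue) measure `dξ` on the torus `𝕋ⁿ = (ℝ/ℤ)ⁿ`. -/
abbrev torusMeasure (n : ℕ) : Measure (UnitAddTorus (Fin n)) :=
  Measure.pi fun _ => AddCircle.haarAddCircle

/-- The Bochner--Lebesgue space `L^p(ℤⁿ, L²(Y, ν))`, with counting measure on `ℤⁿ`. -/
abbrev DiscreteLp (n : ℕ) {Y : Type*} [MeasurableSpace Y] (ν : Measure Y) (p : ℝ≥0∞) :=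
  lp (fun _ : Fin n → ℤ => Lp ℂ 2 ν) p

/-- A bounded operator `T : E → F` is `s`-nuclear if `T f = ∑ₖ ⟨φₖ, f⟩ hₖ` for all `f`, where
`φₖ ∈ E'`, `hₖ ∈ F` and `∑ₖ ‖φₖ‖^s ‖hₖ‖^s < ∞`. -/
def IsSNuclear {E F : Type*} [NormedAddCommGroup E] [NormedSpace ℂ E]
    [NormedAddCommGroup F] [NormedSpace ℂ F] (s : ℝ) (T : E →L[ℂ] F) : Prop :=
  ∃ (φ : ℕ → (E →L[ℂ] ℂ)) (h : ℕ → F),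
    Summable (fun k => ‖φ k‖ ^ s * ‖h k‖ ^ s) ∧
    ∀ f : E, HasSum (fun k => φ k f • h k) (T f)

section Fourier

variable {n : ℕ} {H : Type*} [NormedAddCommGroup H] [NormedSpace ℂ H]

/-- The discrete Fourier transform `(ℱ f)(ξ) = ∑ₓ e^{-2πi x·ξ} f(x)` of a finitely supported
function `f : ℤⁿ → H`. -/
def discreteFourier (f : (Fin n → ℤ) → H) (ξ : UnitAddTorus (Fin n)) : H :=
  ∑' x, UnitAddTorus.mFourier (-x) ξ • f x

/-- The discrete pseudo-differential operator with operator-valued symbol `a`,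
`(𝔱ₐ f)(x) = ∫ e^{2πi x·ξ} a(x, ξ) (ℱ f)(ξ) dξ`, on finitely supported `f`. -/
def discretePDO (a : (Fin n → ℤ) → UnitAddTorus (Fin n) → (H →L[ℂ] H))
    (f : (Fin n → ℤ) → H) (x : Fin n → ℤ) : H :=
  ∫ ξ, UnitAddTorus.mFourier x ξ • a x ξ (discreteFourier f ξ) ∂torusMeasure n

/-- Membership in the Wiener algebra `A(𝕋ⁿ)`: continuous functions whose Fourier coefficients are
absolutely summable. It contains all smooth functions, and all trigonometric polynomials. -/
def IsWiener (φ : C(UnitAddTorus (Fin n), ℂ)) : Prop :=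
  Summable fun y : Fin n → ℤ => ‖UnitAddTorus.mFourierCoeff φ y‖

/-- The discrete Fourier transform of a bounded function `g : ℤⁿ → H` as an `H`-valued
pseudomeasure on `𝕋ⁿ`, i.e. `⟨ℱ g, φ⟩ = ∑_y (∫ e^{-2πi y·ξ} φ(ξ) dξ) g(y)` for `φ ∈ A(𝕋ⁿ)`. -/
def discreteFourierDual (g : (Fin n → ℤ) → H) (φ : C(UnitAddTorus (Fin n), ℂ)) : H :=
  ∑' y, UnitAddTorus.mFourierCoeff φ y • g y

/-- The function `ξ ↦ e^{-2πi x·(-ξ)} φ(-ξ)`. The distribution `e^{-2πi x·ξ} u(-ξ)`, tested on `φ`,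
is by definition `u` tested on this function. -/
def twistedReflection (x : Fin n → ℤ) (φ : C(UnitAddTorus (Fin n), ℂ)) :
    C(UnitAddTorus (Fin n), ℂ) where
  toFun ξ := UnitAddTorus.mFourier (-x) (-ξ) * φ (-ξ)

/-- The summand `ξ ↦ e^{-2πi y·ξ} g(y)` of the Fourier series of `g`, as an element of
`L²(𝕋ⁿ, H)`. -/
def fourierTerm (g : (Fin n → ℤ) → H) (y : Fin n → ℤ) : Lp H 2 (torusMeasure n) :=
  ContinuousMap.toLp 2 (torusMeasure n) ℂ
    ⟨fun ξ => UnitAddTorus.mFourier (-y) ξ • g y, by fun_prop⟩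

/-- The discrete Fourier transform `ℓ²(ℤⁿ, H) → L²(𝕋ⁿ, H)`: the series
`∑_y e^{-2πi y·ξ} g(y)`, summed in `L²(𝕋ⁿ, H)`. -/
def discreteFourierL2 (g : (Fin n → ℤ) → H) : Lp H 2 (torusMeasure n) :=
  ∑' y, fourierTerm g y

end Fourier

section Symbol

variable {n : ℕ} {Y : Type*} [MeasurableSpace Y] {ν : Measure Y}

/-- The product `h ⊗ u` of `h, u ∈ L²(Y, ν)` acting on `v ∈ L²(Y, ν)` as the integral operator with
kernel `h(z) u(w)`: `(h ⊗ u) v = (∫ u(w) v(w) dν(w)) h`. The pairing is bilinear. -/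
def tensorApply (h u v : Lp ℂ 2 ν) : Lp ℂ 2 ν :=
  (∫ w, u w * v w ∂ν) • h

/-- `𝔱ₐ`, initially defined on finitely supported functions, extends to an `s`-nuclear operator
on `L^p(ℤⁿ, L²(Y, ν))`. -/
def DiscretePDOIsSNuclear (s : ℝ) (p : ℝ≥0∞) [Fact (1 ≤ p)]
    (a : (Fin n → ℤ) → UnitAddTorus (Fin n) → (Lp ℂ 2 ν →L[ℂ] Lp ℂ 2 ν)) : Prop :=
  ∃ T : DiscreteLp n ν p →L[ℂ] DiscreteLp n ν p,
    (∀ f : DiscreteLp n ν p, (Function.support (f : (Fin n → ℤ) → Lp ℂ 2 ν)).Finite →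
      ∀ x, T f x = discretePDO a f x) ∧
    IsSNuclear s T

/-- `a(x, ξ) v = e^{-2πi x·ξ} (∑ₖ hₖ(x) ⊗ ℱ gₖ(-ξ)) v` for all `x` and `v`, as an identity of
`L²(Y, ν)`-valued distributions in `ξ ∈ 𝕋ⁿ`; the series converges in the norm of `L²(Y, ν)` after
testing. -/
def SymbolExpansion
    (a : (Fin n → ℤ) → UnitAddTorus (Fin n) → (Lp ℂ 2 ν →L[ℂ] Lp ℂ 2 ν))
    (g h : ℕ → (Fin n → ℤ) → Lp ℂ 2 ν) : Prop :=
  ∀ (x : Fin n → ℤ) (v : Lp ℂ 2 ν) (φ : C(UnitAddTorus (Fin n), ℂ)), IsWiener φ →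
    HasSum
      (fun k => tensorApply (h k x) (discreteFourierDual (g k) (twistedReflection x φ)) v)
      (∫ ξ, φ ξ • a x ξ v ∂torusMeasure n)

/-- `a(x, ξ) v = e^{-2πi x·ξ} (∑ₖ hₖ(x) ⊗ ℱ gₖ(-ξ)) v` for almost every `ξ ∈ 𝕋ⁿ` and all `x` and
`v`, where `ℱ gₖ ∈ L²(𝕋ⁿ, L²(Y, ν))`; the series converges in the norm of `L²(Y, ν)`. -/
def SymbolExpansionAE
    (a : (Fin n → ℤ) → UnitAddTorus (Fin n) → (Lp ℂ 2 ν →L[ℂ] Lp ℂ 2 ν))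
    (g h : ℕ → (Fin n → ℤ) → Lp ℂ 2 ν) : Prop :=
  ∀ᵐ ξ ∂torusMeasure n, ∀ (x : Fin n → ℤ) (v : Lp ℂ 2 ν),
    HasSum
      (fun k => UnitAddTorus.mFourier (-x) ξ •
        tensorApply (h k x) (discreteFourierL2 (g k) (-ξ)) v)
      (a x ξ v)

end Symbol

end

/-! On finitely supported functions `𝔱ₐ` acts by the operator-valued matrix `K(x, y) v = ∫ e^{2πi
(x-y)·ξ} a(x, ξ) v dξ`, whose entries are Fourier coefficients of `ξ ↦ a(x, ξ) v`. As `p < ∞`,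
functionals on `ℓᵖ(ℤⁿ, H)` are sequences in `ℓ^{p'}(ℤⁿ, H)`, so `s`-nuclearity amounts to `K(x, y) =
∑ₖ hₖ(x) ⊗ gₖ(y)` with the stated summability. This identity, `SymbolCoefficients`, is the pivot:
under that summability each form of the symbol expansion is equivalent to it. Since `s ≤ 1`, also
`∑ₖ ‖hₖ‖ ‖gₖ‖ < ∞`, which justifies every interchange of limits.

For distributions, testing on characters yields the coefficients; conversely a Wiener function is an
absolutely convergent sum of characters, and a double sum is rearranged
(`SymbolCoefficients.symbolExpansion`).

For the pointwise form, `p ≥ 2` gives `p' ≤ 2`, so `ℱ gₖ` lies in `L²` with norm at most `‖gₖ‖` and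
the series converges absolutely almost everywhere. Its sum and `a(x, ξ) v` are integrable with equal
Fourier coefficients, hence equal a.e. for fixed `x`, `v`; separability of `H` makes the null set
independent of `v`. -/

/-! ### Bilinear self-duality of `L²(Y, ν)` -/

section Pairing

variable {Y : Type*} [MeasurableSpace Y] (ν : Measure Y)

/-- The bilinear pairing `(u, v) ↦ ∫ u v dν` on `L²(Y, ν)`. -/
noncomputable def l2Pairing : Lp ℂ 2 ν →L[ℂ] Lp ℂ 2 ν →L[ℂ] ℂ :=
  (ContinuousLinearMap.mul ℂ ℂ).lpPairing ν 2 2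

theorem l2Pairing_apply (u v : Lp ℂ 2 ν) : l2Pairing ν u v = ∫ w, u w * v w ∂ν := by
  simp [l2Pairing, ContinuousLinearMap.lpPairing_eq_integral]

theorem tensorApply_eq (h u v : Lp ℂ 2 ν) : tensorApply h u v = l2Pairing ν u v • h := by
  rw [tensorApply, l2Pairing_apply]

/-- Conjugating one argument turns the bilinear pairing into the inner product, which makes
Cauchy–Schwarz and the Riesz representation available. -/
theorem l2Pairing_star (u v : Lp ℂ 2 ν) : l2Pairing ν (star u) v = inner ℂ u v := by
  rw [l2Pairing_apply, L2.inner_def]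
  refine integral_congr_ae ?_
  filter_upwards [Lp.coeFn_star u] with w hw
  simp [hw, mul_comm]

theorem norm_star_l2 (u : Lp ℂ 2 ν) : ‖star u‖ = ‖u‖ := by
  rw [Lp.norm_def, Lp.norm_def]
  congr 1
  refine eLpNorm_congr_norm_ae ?_
  filter_upwards [Lp.coeFn_star u] with w hw
  simp [hw]

theorem norm_l2Pairing_apply_le (u v : Lp ℂ 2 ν) : ‖l2Pairing ν u v‖ ≤ ‖u‖ * ‖v‖ := by
  rw [← star_star u, l2Pairing_star, norm_star_l2]
  exact norm_inner_le_norm _ _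

theorem norm_l2Pairing_le : ‖l2Pairing ν‖ ≤ 1 :=
  ContinuousLinearMap.opNorm_le_bound₂ _ zero_le_one fun u v => by
    simpa using norm_l2Pairing_apply_le ν u v

theorem exists_l2Pairing_eq (l : Lp ℂ 2 ν →L[ℂ] ℂ) :
    ∃ u : Lp ℂ 2 ν, l2Pairing ν u = l ∧ ‖u‖ = ‖l‖ := by
  refine ⟨star ((InnerProductSpace.toDual ℂ _).symm l), ?_, ?_⟩
  · ext v
    rw [l2Pairing_star, InnerProductSpace.toDual_symm_apply]
  · rw [norm_star_l2, LinearIsometryEquiv.norm_map]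

end Pairing

/-! ### The dual of `ℓᵖ(α, H)` -/

section SequenceDuality

variable {α H : Type*} [NormedAddCommGroup H] [InnerProductSpace ℂ H] [CompleteSpace H]

/-- The witness is the normalised Riesz vector. For `l = 0` the convention `0⁻¹ = 0` makes it zero,
hence `≤ 1` rather than `= 1`. -/
theorem exists_norm_le_one_apply_eq_norm (l : H →L[ℂ] ℂ) :
    ∃ e : H, ‖e‖ ≤ 1 ∧ l e = ‖l‖ := by
  set u := (InnerProductSpace.toDual ℂ H).symm l with hu
  have hn : ‖u‖ = ‖l‖ := by simp [hu]
  refine ⟨((‖u‖⁻¹ : ℝ) : ℂ) • u, ?_, ?_⟩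
  · rw [norm_smul]
    simpa using inv_mul_le_one
  · rw [map_smul, ← InnerProductSpace.toDual_symm_apply, ← hu, inner_self_eq_norm_sq_to_K,
      ← hn]
    rcases eq_or_ne ‖u‖ 0 with h | h
    · simp [h]
    · have : (‖u‖ : ℂ) ≠ 0 := by exact_mod_cast h
      simp only [smul_eq_mul, Complex.ofReal_inv, Complex.coe_algebraMap]
      field_simp

variable [DecidableEq α] {p q : ℝ≥0∞} [Fact (1 ≤ p)]

/-- The functional is tested on `∑ c_y e_y`, where `e_y` norms the `y`-th component of `φ` and the
weights `c_y` are extremal in Hölder's inequality on the finite set. -/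
theorem sum_norm_rpow_le_of_dual_lp (hp : p.toReal.HolderConjugate q.toReal)
    (φ : lp (fun _ : α => H) p →L[ℂ] ℂ) (s : Finset α) :
    ∑ y ∈ s, ‖φ.comp (lp.singleContinuousLinearMap ℂ (fun _ : α => H) p y)‖ ^ q.toReal ≤
      ‖φ‖ ^ q.toReal := by
  set l : α → H →L[ℂ] ℂ := fun y => φ.comp (lp.singleContinuousLinearMap ℂ (fun _ : α => H) p y)
    with hl
  choose e he hle using fun y => exists_norm_le_one_apply_eq_norm (l y)
  obtain ⟨⟨c, hc, hcs⟩, -⟩ := NNReal.isGreatest_Lp s (fun y => ‖l y‖₊) hp.symm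
  simp only [Set.mem_ofPred_eq] at hc hcs
  set f : lp (fun _ : α => H) p := ∑ y ∈ s, lp.single p y ((c y : ℂ) • e y) with hf
  have hfn : ‖f‖ ≤ 1 := by
    rw [← Real.rpow_le_rpow_iff (norm_nonneg _) zero_le_one hp.pos, Real.one_rpow, hf,
      lp.norm_sum_single hp.pos (fun y => (c y : ℂ) • e y)]
    refine le_trans (Finset.sum_le_sum (g := fun y => (c y : ℝ) ^ p.toReal) fun y _ => ?_) ?_
    · refine Real.rpow_le_rpow (norm_nonneg _) ?_ hp.nonneg
      rw [norm_smul]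
      simpa using mul_le_mul_of_nonneg_left (he y) (c y).2
    · exact_mod_cast hc
  have hφf : φ f = ((∑ y ∈ s, ‖l y‖ * c y : ℝ) : ℂ) := by
    rw [hf, map_sum, Complex.ofReal_sum]
    refine Finset.sum_congr rfl fun y _ => ?_
    have : φ (lp.single p y ((c y : ℂ) • e y)) = l y ((c y : ℂ) • e y) := rfl
    rw [this, map_smul, hle]
    simp [mul_comm]
  have key : (∑ y ∈ s, ‖l y‖ ^ q.toReal) ^ (1 / q.toReal) ≤ ‖φ‖ := by
    have h1 : (∑ y ∈ s, ‖l y‖ ^ q.toReal) ^ (1 / q.toReal) = ∑ y ∈ s, ‖l y‖ * c y := by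
      have := congrArg ((↑) : NNReal → ℝ) hcs.symm
      push_cast at this
      exact this
    rw [h1]
    calc ∑ y ∈ s, ‖l y‖ * c y = ‖φ f‖ := by
          rw [hφf, Complex.norm_real, Real.norm_of_nonneg]
          positivity
      _ ≤ ‖φ‖ * ‖f‖ := φ.le_opNorm f
      _ ≤ ‖φ‖ := mul_le_of_le_one_right φ.opNorm_nonneg hfn
  have hpos : 0 ≤ ∑ y ∈ s, ‖l y‖ ^ q.toReal := by positivity
  calc ∑ y ∈ s, ‖l y‖ ^ q.toReal
      = ((∑ y ∈ s, ‖l y‖ ^ q.toReal) ^ (1 / q.toReal)) ^ q.toReal := by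
        rw [← Real.rpow_mul hpos, one_div_mul_cancel hp.symm.ne_zero, Real.rpow_one]
    _ ≤ ‖φ‖ ^ q.toReal := by gcongr

/-- A continuous functional on `ℓᵖ(α, H)`, `p < ∞`, is given by a sequence of functionals
in `ℓ^q(α, H')`. -/
theorem exists_lp_of_dual_lp (hp : p ≠ ∞) [hpq : p.HolderConjugate q]
    (φ : lp (fun _ : α => H) p →L[ℂ] ℂ) :
    ∃ g : lp (fun _ : α => H →L[ℂ] ℂ) q, ‖g‖ ≤ ‖φ‖ ∧ ∀ y v, φ (lp.single p y v) = g y v := by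
  have hp1 : (1 : ℝ≥0∞) ≤ p := Fact.out
  set l : α → H →L[ℂ] ℂ := fun y => φ.comp (lp.singleContinuousLinearMap ℂ (fun _ : α => H) p y)
    with hl
  -- The case `q = ∞`, that is `p = 1`, needs only a test on single coordinates.
  rcases eq_or_ne q ∞ with rfl | hq
  · have hb : ∀ y, ‖l y‖ ≤ ‖φ‖ := fun y => by
      refine ContinuousLinearMap.opNorm_le_bound _ φ.opNorm_nonneg fun v => ?_
      have h := φ.le_opNorm (lp.single p y v)
      rwa [lp.norm_single (E := fun _ : α => H) (zero_lt_one.trans_le hp1) y v] at h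
    let g : lp (fun _ : α => H →L[ℂ] ℂ) ∞ :=
      ⟨l, memℓp_infty ⟨‖φ‖, by rintro _ ⟨y, rfl⟩; exact hb y⟩⟩
    have hg : ‖g‖ ≤ ‖φ‖ := lp.norm_le_of_forall_le φ.opNorm_nonneg hb
    exact ⟨g, hg, fun y v => rfl⟩
  · have hq1 : (1 : ℝ≥0∞) ≤ q := ENNReal.HolderTriple.le q p 1
    have hconj : p.toReal.HolderConjugate q.toReal := by
      have := ENNReal.HolderTriple.toReal (p := p) (q := q) 1
        (ENNReal.toReal_pos (by positivity) hp) (ENNReal.toReal_pos (by positivity) hq)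
      simpa using this
    have hb := sum_norm_rpow_le_of_dual_lp hconj φ
    let g : lp (fun _ : α => H →L[ℂ] ℂ) q := ⟨l, memℓp_gen' hb⟩
    have hg : ‖g‖ ≤ ‖φ‖ :=
      lp.norm_le_of_forall_sum_le hconj.symm.pos φ.opNorm_nonneg hb
    exact ⟨g, hg, fun y v => rfl⟩

end SequenceDuality

/-! ### Fourier coefficients of integrable vector-valued functions on the torus -/

section TorusFourier

open UnitAddTorus Filter Topology

variable {n : ℕ}

theorem norm_mFourier_apply (y : Fin n → ℤ) (ξ : UnitAddTorus (Fin n)) : ‖mFourier y ξ‖ = 1 := by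
  simp only [mFourier, ContinuousMap.coe_mk, fourier_apply, norm_prod]
  exact Finset.prod_eq_one fun _ _ => Circle.norm_coe _

theorem mFourier_apply_neg (y : Fin n → ℤ) (ξ : UnitAddTorus (Fin n)) :
    mFourier y (-ξ) = mFourier (-y) ξ := by
  simp [mFourier, fourier_apply]

instance isNegInvariant_haarAddCircle :
    (AddCircle.haarAddCircle : Measure UnitAddCircle).IsNegInvariant := by
  have : (AddCircle.haarAddCircle : Measure UnitAddCircle).Regular :=
    inferInstanceAs (Measure.addHaarMeasure ⊤ : Measure UnitAddCircle).Regular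
  infer_instance

instance isNegInvariant_torusMeasure : (torusMeasure n).IsNegInvariant :=
  Measure.pi.isNegInvariant _

theorem integral_mFourier (y : Fin n → ℤ) :
    ∫ ξ, mFourier y ξ ∂torusMeasure n = if y = 0 then 1 else 0 := by
  have h := orthonormal_iff_ite.mp (orthonormal_mFourier (d := Fin n)) 0 y
  simp only [ContinuousMap.inner_toLp, ← mFourier_neg, ← mFourier_add] at h
  simp only [neg_zero, add_zero, eq_comm (a := (0 : Fin n → ℤ))] at h
  exact h

theorem mFourierCoeff_eq {E : Type*} [NormedAddCommGroup E] [NormedSpace ℂ E]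
    (f : UnitAddTorus (Fin n) → E) (y : Fin n → ℤ) :
    mFourierCoeff f y = ∫ ξ, mFourier (-y) ξ • f ξ ∂torusMeasure n := rfl

theorem mFourierCoeff_mFourier (z y : Fin n → ℤ) :
    mFourierCoeff (mFourier z) y = if y = z then 1 else 0 := by
  rw [mFourierCoeff_eq]
  simp only [smul_eq_mul, ← mFourier_add, integral_mFourier, neg_add_eq_zero]

theorem isWiener_mFourier (z : Fin n → ℤ) : IsWiener (mFourier z) := by
  refine summable_of_ne_finset_zero (s := {z}) fun y hy => ?_
  rw [mFourierCoeff_mFourier, if_neg (by simpa using hy), norm_zero]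

/-- After `ξ ↦ -ξ` the twist becomes a shift of the frequency. This matches the expansion with the
matrix entries, which are indexed by `x - y`. -/
theorem mFourierCoeff_twistedReflection (x y : Fin n → ℤ) (φ : C(UnitAddTorus (Fin n), ℂ)) :
    mFourierCoeff (twistedReflection x φ) y = mFourierCoeff φ (x - y) := by
  rw [mFourierCoeff_eq, mFourierCoeff_eq, ← integral_neg_eq_self]
  refine integral_congr_ae (.of_forall fun ξ => ?_)
  simp only [twistedReflection, ContinuousMap.coe_mk, neg_neg, mFourier_apply_neg, smul_eq_mul]
  rw [← mul_assoc, ← mFourier_add]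
  congr 3
  abel

variable {E : Type*} [NormedAddCommGroup E] [NormedSpace ℂ E]

theorem MeasureTheory.Integrable.continuousMap_smul {F : UnitAddTorus (Fin n) → E}
    (hF : Integrable F (torusMeasure n)) (φ : C(UnitAddTorus (Fin n), ℂ)) :
    Integrable (fun ξ => φ ξ • F ξ) (torusMeasure n) :=
  hF.bdd_smul ‖φ‖ φ.continuous.aestronglyMeasurable (.of_forall φ.norm_coe_le_norm)

/-- Integration of continuous functions against an integrable vector-valued density. -/
noncomputable def integralAgainst {F : UnitAddTorus (Fin n) → E}
    (hF : Integrable F (torusMeasure n)) : C(UnitAddTorus (Fin n), ℂ) →L[ℂ] E :=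
  LinearMap.mkContinuous
    { toFun := fun φ => ∫ ξ, φ ξ • F ξ ∂torusMeasure n
      map_add' := fun φ ψ => by
        simp only [ContinuousMap.add_apply, add_smul]
        exact integral_add (hF.continuousMap_smul φ) (hF.continuousMap_smul ψ)
      map_smul' := fun c φ => by
        simp only [ContinuousMap.smul_apply, smul_assoc, RingHom.id_apply]
        exact integral_smul c _ }
    (∫ ξ, ‖F ξ‖ ∂torusMeasure n) fun φ => by
      refine (norm_integral_le_integral_norm _).trans ?_
      rw [mul_comm, ← integral_const_mul]
      refine integral_mono (hF.continuousMap_smul φ).norm (hF.norm.const_mul _) fun ξ => ?_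
      simp only [norm_smul]
      gcongr
      exact φ.norm_coe_le_norm ξ

theorem integralAgainst_apply {F : UnitAddTorus (Fin n) → E}
    (hF : Integrable F (torusMeasure n)) (φ : C(UnitAddTorus (Fin n), ℂ)) :
    integralAgainst hF φ = ∫ ξ, φ ξ • F ξ ∂torusMeasure n := rfl

/-- Parseval's formula for a function in the Wiener algebra and an integrable function. -/
theorem IsWiener.hasSum_integral_smul {φ : C(UnitAddTorus (Fin n), ℂ)} (hφ : IsWiener φ)
    {F : UnitAddTorus (Fin n) → E} (hF : Integrable F (torusMeasure n)) :
    HasSum (fun z => mFourierCoeff φ z • ∫ ξ, mFourier z ξ • F ξ ∂torusMeasure n)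
      (∫ ξ, φ ξ • F ξ ∂torusMeasure n) := by
  have h := (integralAgainst hF).hasSum (hasSum_mFourier_series_of_summable (f := φ) hφ.of_norm)
  simp only [map_smul, integralAgainst_apply] at h
  exact h

/-- The kernel of integration against `F` is closed and contains the characters, whose span is dense
in `C(𝕋ⁿ)`. -/
theorem integral_continuousMap_smul_eq_zero {F : UnitAddTorus (Fin n) → E}
    (hF : Integrable F (torusMeasure n))
    (h : ∀ z : Fin n → ℤ, ∫ ξ, mFourier z ξ • F ξ ∂torusMeasure n = 0)
    (φ : C(UnitAddTorus (Fin n), ℂ)) : ∫ ξ, φ ξ • F ξ ∂torusMeasure n = 0 := by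
  have hle : Submodule.span ℂ (Set.range (mFourier (d := Fin n))) ≤
      (integralAgainst hF).toLinearMap.ker :=
    Submodule.span_le.mpr (by rintro _ ⟨z, rfl⟩; exact h z)
  have := Submodule.topologicalClosure_minimal _ hle (integralAgainst hF).isClosed_ker
  rw [span_mFourier_closure_eq_top] at this
  exact this (Submodule.mem_top (x := φ))

/-- An integrable function on the torus all of whose Fourier coefficients vanish is zero. -/
theorem ae_eq_zero_of_integral_mFourier_smul_eq_zero [CompleteSpace E]
    {F : UnitAddTorus (Fin n) → E} (hF : Integrable F (torusMeasure n))
    (h : ∀ z : Fin n → ℤ, ∫ ξ, mFourier z ξ • F ξ ∂torusMeasure n = 0) :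
    F =ᵐ[torusMeasure n] 0 := by
  -- Integrals over closed sets determine `F`, and the indicator of a closed set is a bounded
  -- pointwise limit of continuous functions.
  refine ae_eq_zero_of_forall_setIntegral_isClosed_eq_zero hF fun s hs => ?_
  rw [← integral_indicator hs.measurableSet]
  have hδ : ∀ k : ℕ, 0 < ((1 : ℝ) / ((k : ℝ) + 1)) := fun k => Nat.one_div_pos_of_nat
  have hlim := thickenedIndicator_tendsto_indicator_closure hδ
    tendsto_one_div_add_atTop_nhds_zero_nat s
  rw [hs.closure_eq, tendsto_pi_nhds] at hlim
  let ψ : ℕ → C(UnitAddTorus (Fin n), ℂ) := fun k =>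
    ⟨fun ξ => ((thickenedIndicator (hδ k) s ξ : ℝ) : ℂ), by fun_prop⟩
  have hz : ∀ k, ∫ ξ, ψ k ξ • F ξ ∂torusMeasure n = 0 := fun k =>
    integral_continuousMap_smul_eq_zero hF h (ψ k)
  have ht : Tendsto (fun k => ∫ ξ, ψ k ξ • F ξ ∂torusMeasure n) atTop
      (𝓝 (∫ ξ, s.indicator F ξ ∂torusMeasure n)) := by
    refine tendsto_integral_of_dominated_convergence (fun ξ => ‖F ξ‖)
      (fun k => (hF.continuousMap_smul (ψ k)).aestronglyMeasurable) hF.norm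
      (fun k => .of_forall fun ξ => ?_) (.of_forall fun ξ => ?_)
    · rw [norm_smul]
      refine mul_le_of_le_one_left (norm_nonneg _) ?_
      have := thickenedIndicator_le_one (hδ k) s ξ
      simpa [ψ] using this
    · have h1 : Tendsto (fun k => ψ k ξ) atTop
          (𝓝 ((((s.indicator (fun _ => (1 : NNReal)) ξ : NNReal) : ℝ) : ℂ))) :=
        ((Complex.continuous_ofReal.comp NNReal.continuous_coe).tendsto _).comp (hlim ξ)
      convert! h1.smul_const (F ξ) using 2
      by_cases hξ : ξ ∈ s <;> simp [hξ]
  simp only [hz] at ht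
  exact tendsto_nhds_unique ht tendsto_const_nhds

end TorusFourier

/-! ### Plancherel for `H`-valued Fourier series -/

section FourierL2

open UnitAddTorus

variable {n : ℕ} {H : Type*} [NormedAddCommGroup H] [InnerProductSpace ℂ H]

theorem coeFn_fourierTerm (g : (Fin n → ℤ) → H) (y : Fin n → ℤ) :
    fourierTerm g y =ᵐ[torusMeasure n] fun ξ => mFourier (-y) ξ • g y :=
  ContinuousMap.coeFn_toLp _ _

theorem inner_fourierTerm (g g' : (Fin n → ℤ) → H) (y z : Fin n → ℤ) :
    inner ℂ (fourierTerm g y) (fourierTerm g' z) = if y = z then inner ℂ (g y) (g' z) else 0 := by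
  rw [L2.inner_def]
  have : ∀ᵐ ξ ∂torusMeasure n, inner ℂ (fourierTerm g y ξ) (fourierTerm g' z ξ) =
      mFourier (y - z) ξ * inner ℂ (g y) (g' z) := by
    filter_upwards [coeFn_fourierTerm g y, coeFn_fourierTerm g' z] with ξ h1 h2
    rw [h1, h2, inner_smul_left, inner_smul_right, ← mFourier_neg, neg_neg, ← mul_assoc,
      ← mFourier_add, sub_eq_add_neg]
  rw [integral_congr_ae this, integral_mul_const, integral_mFourier]
  simp only [sub_eq_zero, ite_mul, one_mul, zero_mul]

/-- The embedding `v ↦ e^{-2πi y·ξ} v` of `H` into `L²(𝕋ⁿ, H)`. -/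
noncomputable def fourierTermIsometry (y : Fin n → ℤ) : H →ₗᵢ[ℂ] Lp H 2 (torusMeasure n) where
  toFun v := fourierTerm (fun _ => v) y
  map_add' v w := by
    simp only [fourierTerm]
    rw [← map_add]
    congr 1
    ext ξ
    simp
  map_smul' c v := by
    simp only [fourierTerm, RingHom.id_apply]
    rw [← map_smul]
    congr 1
    ext ξ
    simp [smul_comm c]
  norm_map' v := by
    change ‖fourierTerm (fun _ => v) y‖ = ‖v‖
    rw [← sq_eq_sq₀ (norm_nonneg _) (norm_nonneg _), ← @inner_self_eq_norm_sq ℂ,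
      inner_fourierTerm, if_pos rfl, inner_self_eq_norm_sq]

theorem orthogonalFamily_fourierTerm :
    OrthogonalFamily ℂ (fun _ : Fin n → ℤ => H) fourierTermIsometry := fun y z hyz v w => by
  have := inner_fourierTerm (fun _ => v) (fun _ => w) y z
  rwa [if_neg hyz] at this

variable [CompleteSpace H]

theorem hasSum_discreteFourierL2 (g : lp (fun _ : Fin n → ℤ => H) 2) :
    HasSum (fourierTerm g) (discreteFourierL2 (g : (Fin n → ℤ) → H)) :=
  (orthogonalFamily_fourierTerm.summable_of_lp g).hasSum

theorem norm_discreteFourierL2 (g : lp (fun _ : Fin n → ℤ => H) 2) :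
    ‖discreteFourierL2 (g : (Fin n → ℤ) → H)‖ = ‖g‖ := by
  rw [← (orthogonalFamily_fourierTerm (n := n) (H := H)).linearIsometry.norm_map g,
    OrthogonalFamily.linearIsometry_apply]
  rfl

/-- `f ↦ ∫ e^{2πi y·ξ} ⟨v, f(ξ)⟩ dξ` is an inner product in `L²(𝕋ⁿ, H)`. -/
theorem inner_fourierTerm_left (v : H) (y : Fin n → ℤ) (f : Lp H 2 (torusMeasure n)) :
    inner ℂ (fourierTerm (fun _ => v) y) f =
      inner ℂ v (∫ ξ, mFourier y ξ • f ξ ∂torusMeasure n) := by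
  have hf : Integrable f (torusMeasure n) := (Lp.memLp f).integrable one_le_two
  rw [← integral_inner (hf.continuousMap_smul _), L2.inner_def]
  refine integral_congr_ae ?_
  filter_upwards [coeFn_fourierTerm (fun _ => v) y] with ξ hξ
  rw [hξ, inner_smul_left, inner_smul_right, ← mFourier_neg, neg_neg]

theorem integral_mFourier_smul_discreteFourierL2 (g : lp (fun _ : Fin n → ℤ => H) 2)
    (y : Fin n → ℤ) :
    ∫ ξ, mFourier y ξ • discreteFourierL2 (g : (Fin n → ℤ) → H) ξ ∂torusMeasure n = g y := by
  -- Paired with `v`, the coefficient is an `L²` inner product, and orthogonality leaves a single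
  -- term of the series.
  refine ext_inner_left ℂ fun v => ?_
  rw [← inner_fourierTerm_left]
  have h := (hasSum_discreteFourierL2 g).mapL (innerSL ℂ (fourierTerm (fun _ => v) y))
  simp only [innerSL_apply_apply, inner_fourierTerm] at h
  refine h.unique ?_
  convert! hasSum_ite_eq y (inner ℂ v (g y)) using 2 with z
  by_cases hz : z = y
  · simp [hz]
  · simp [hz, Ne.symm hz]

end FourierL2

/-! ### Summability and series of integrable functions -/

section Series

open Filter

/-- The terms `u k ^ s` tend to zero, so eventually `u k ≤ 1`, and then `u k ≤ u k ^ s`. -/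
theorem summable_of_summable_rpow {s : ℝ} (hs₀ : 0 < s) (hs₁ : s ≤ 1) {u : ℕ → ℝ}
    (hu : ∀ k, 0 ≤ u k) (h : Summable fun k => u k ^ s) : Summable u := by
  refine Summable.of_norm_bounded_eventually_nat h ?_
  filter_upwards [h.tendsto_atTop_zero.eventually (gt_mem_nhds zero_lt_one)] with k hk
  have h1 : u k ≤ 1 := by
    by_contra! h2
    exact absurd (Real.one_lt_rpow h2 hs₀) (not_lt.mpr hk.le)
  rw [Real.norm_of_nonneg (hu k)]
  calc u k = u k ^ (1 : ℝ) := (Real.rpow_one _).symm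
    _ ≤ u k ^ s := Real.rpow_le_rpow_of_exponent_ge_of_imp (hu k) h1 hs₁
      (fun _ h => absurd h one_ne_zero)

theorem summable_mul_of_summable_rpow {s : ℝ} (hs₀ : 0 < s) (hs₁ : s ≤ 1) {u v : ℕ → ℝ}
    (hu : ∀ k, 0 ≤ u k) (hv : ∀ k, 0 ≤ v k) (h : Summable fun k => u k ^ s * v k ^ s) :
    Summable fun k => u k * v k :=
  summable_of_summable_rpow hs₀ hs₁ (fun k => mul_nonneg (hu k) (hv k))
    (h.congr fun k => (Real.mul_rpow (hu k) (hv k)).symm)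

variable {α E : Type*} [MeasurableSpace α] {μ : Measure α} [NormedAddCommGroup E]
  {F : ℕ → α → E}

theorem tsum_lintegral_enorm_ne_top_of_summable (hF : ∀ k, Integrable (F k) μ)
    (hs : Summable fun k => ∫ a, ‖F k a‖ ∂μ) : ∫⁻ a, ∑' k, ‖F k a‖ₑ ∂μ ≠ ∞ := by
  rw [lintegral_tsum fun k => (hF k).1.enorm]
  have : ∀ k, ∫⁻ a, ‖F k a‖ₑ ∂μ = ENNReal.ofReal (∫ a, ‖F k a‖ ∂μ) := fun k =>
    (ofReal_integral_norm_eq_lintegral_enorm (hF k)).symm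
  simp only [this]
  rw [← ENNReal.ofReal_tsum_of_nonneg (fun k => integral_nonneg fun a => norm_nonneg _) hs]
  exact ENNReal.ofReal_ne_top

theorem ae_summable_norm_of_summable_integral_norm (hF : ∀ k, Integrable (F k) μ)
    (hs : Summable fun k => ∫ a, ‖F k a‖ ∂μ) : ∀ᵐ a ∂μ, Summable fun k => ‖F k a‖ := by
  filter_upwards [ae_lt_top' (AEMeasurable.tsum fun k => (hF k).1.enorm)
    (tsum_lintegral_enorm_ne_top_of_summable hF hs)] with a ha
  exact NNReal.summable_coe.mpr (ENNReal.tsum_coe_ne_top_iff_summable.mp ha.ne)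

theorem integrable_tsum_of_summable_integral_norm [CompleteSpace E]
    (hF : ∀ k, Integrable (F k) μ) (hs : Summable fun k => ∫ a, ‖F k a‖ ∂μ) :
    Integrable (fun a => ∑' k, F k a) μ := by
  refine ⟨?_, ?_⟩
  · refine aestronglyMeasurable_of_tendsto_ae atTop
      (f := fun (N : ℕ) a => ∑ k ∈ Finset.range N, F k a)
      (fun N => Finset.aestronglyMeasurable_fun_sum _ fun k _ => (hF k).1) ?_
    filter_upwards [ae_summable_norm_of_summable_integral_norm hF hs] with a ha
    exact ha.of_norm.hasSum.tendsto_sum_nat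
  · refine lt_of_le_of_lt (lintegral_mono fun a => ?_)
      (tsum_lintegral_enorm_ne_top_of_summable hF hs).lt_top
    exact enorm_tsum_le_tsum_enorm

end Series

/-! ### Inclusions and functionals on sequence spaces -/

section SequenceSpaces

variable {α : Type*} {E : α → Type*} [∀ i, NormedAddCommGroup (E i)]

/-- The inclusion `ℓ^p ⊆ ℓ^q` for `p ≤ q < ∞` is a contraction. -/
theorem lp.norm_inclusion_le {p q : ℝ≥0∞} (hp : p ≠ 0) (hpq : p ≤ q) (hq : q ≠ ∞)
    (g : lp E p) : ‖(⟨g, (lp.memℓp g).of_exponent_ge hpq⟩ : lp E q)‖ ≤ ‖g‖ := by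
  have hp0 : 0 < p.toReal := ENNReal.toReal_pos hp (ne_top_of_le_ne_top hq hpq)
  have hle : p.toReal ≤ q.toReal := ENNReal.toReal_mono hq hpq
  have hq0 : 0 < q.toReal := hp0.trans_le hle
  refine lp.norm_le_of_forall_sum_le hq0 (lp.norm_nonneg' _) fun s => ?_
  calc ∑ i ∈ s, ‖g i‖ ^ q.toReal
      ≤ ∑ i ∈ s, ‖g i‖ ^ p.toReal * ‖g‖ ^ (q.toReal - p.toReal) := by
        refine Finset.sum_le_sum fun i _ => ?_
        calc ‖g i‖ ^ q.toReal = ‖g i‖ ^ p.toReal * ‖g i‖ ^ (q.toReal - p.toReal) := by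
              rw [← Real.rpow_add_of_nonneg (norm_nonneg _) hp0.le (sub_nonneg.mpr hle)]
              congr 1
              ring
          _ ≤ _ := by
              gcongr
              exact lp.norm_apply_le_norm hp g i
    _ ≤ ‖g‖ ^ p.toReal * ‖g‖ ^ (q.toReal - p.toReal) := by
        rw [← Finset.sum_mul]
        exact mul_le_mul_of_nonneg_right (lp.sum_rpow_le_norm_rpow hp0 g s)
          (Real.rpow_nonneg (lp.norm_nonneg' _) _)
    _ = ‖g‖ ^ q.toReal := by
        rw [← Real.rpow_add_of_nonneg (lp.norm_nonneg' _) hp0.le (sub_nonneg.mpr hle)]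
        congr 1
        ring

end SequenceSpaces

section SequenceFunctionals

variable {n : ℕ} {Y : Type*} [MeasurableSpace Y] {ν : Measure Y} {p q : ℝ≥0∞} [Fact (1 ≤ p)]

theorem exists_discreteLp_of_dual (hp : p ≠ ∞) [hpq : p.HolderConjugate q]
    (φ : DiscreteLp n ν p →L[ℂ] ℂ) :
    ∃ g : DiscreteLp n ν q, ‖g‖ ≤ ‖φ‖ ∧
      ∀ y v, φ (lp.single p y v) = l2Pairing ν (g y) v := by
  obtain ⟨G, hG, hGφ⟩ := exists_lp_of_dual_lp (q := q) hp φ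
  choose u hu hun using exists_l2Pairing_eq ν
  have hmem : Memℓp (fun y => u (G y)) q := by
    refine (lp.memℓp G).norm.mono fun y => ?_
    rw [hun]
  let g : DiscreteLp n ν q := ⟨fun y => u (G y), hmem⟩
  have hgn : ‖g‖ ≤ ‖G‖ :=
    lp.norm_mono (ENNReal.HolderConjugate.pos q p).ne' fun y => (hun (G y)).le
  refine ⟨g, hgn.trans hG, fun y v => ?_⟩
  rw [hGφ]
  exact congrArg (fun l => l v) (hu (G y)).symm

variable (ν) in
/-- The functional `f ↦ ∑_y ∫ g(y) f(y) dν` on `ℓᵖ(ℤⁿ, L²(Y, ν))` given by `g ∈ ℓ^{p'}`. -/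
noncomputable def discreteLpFunctional [Fact (1 ≤ q)] [hpq : q.HolderConjugate p]
    (g : DiscreteLp n ν q) : DiscreteLp n ν p →L[ℂ] ℂ :=
  lp.dualPairing q p (fun _ : Fin n → ℤ => l2Pairing ν) (K := 1)
    (fun _ => norm_l2Pairing_le ν) g

theorem discreteLpFunctional_apply [Fact (1 ≤ q)] [hpq : q.HolderConjugate p]
    (g : DiscreteLp n ν q) (f : DiscreteLp n ν p) :
    discreteLpFunctional ν g f = ∑' y, l2Pairing ν (g y) (f y) := rfl

theorem norm_discreteLpFunctional_le [Fact (1 ≤ q)] [hpq : q.HolderConjugate p]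
    (g : DiscreteLp n ν q) : ‖(discreteLpFunctional ν g : DiscreteLp n ν p →L[ℂ] ℂ)‖ ≤ ‖g‖ := by
  have h1 := lp.norm_dualPairing (p := q) (q := p) (fun _ : Fin n → ℤ => l2Pairing ν) (K := 1)
    (fun _ => norm_l2Pairing_le ν)
  have h2 := ContinuousLinearMap.le_of_opNorm_le _ h1 g
  simpa using! h2

end SequenceFunctionals

/-! ### Matrix entries, nuclearity and the distributional expansion -/

section Symbol

open UnitAddTorus

variable {n : ℕ} {Y : Type*} [MeasurableSpace Y] {ν : Measure Y}

theorem norm_tensorApply_le (h u v : Lp ℂ 2 ν) : ‖tensorApply h u v‖ ≤ ‖h‖ * ‖u‖ * ‖v‖ := by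
  rw [tensorApply_eq, norm_smul]
  calc ‖l2Pairing ν u v‖ * ‖h‖ ≤ ‖u‖ * ‖v‖ * ‖h‖ := by
        gcongr
        exact norm_l2Pairing_apply_le ν u v
    _ = _ := by ring

/-- `tensorApply` as a continuous linear function of its second argument. -/
noncomputable def tensorMap (h v : Lp ℂ 2 ν) : Lp ℂ 2 ν →L[ℂ] Lp ℂ 2 ν :=
  ((l2Pairing ν).flip v).smulRight h

theorem tensorMap_apply (h u v : Lp ℂ 2 ν) : tensorMap h v u = tensorApply h u v := by
  rw [tensorApply_eq]
  rfl

/-- The Fourier coefficients of `ξ ↦ a(x, ξ) v` are `∑ₖ (hₖ(x) ⊗ gₖ(y)) v`. -/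
def SymbolCoefficients (a : (Fin n → ℤ) → UnitAddTorus (Fin n) → (Lp ℂ 2 ν →L[ℂ] Lp ℂ 2 ν))
    (g h : ℕ → (Fin n → ℤ) → Lp ℂ 2 ν) : Prop :=
  ∀ (x y : Fin n → ℤ) (v : Lp ℂ 2 ν),
    HasSum (fun k => tensorApply (h k x) (g k y) v)
      (∫ ξ, mFourier (x - y) ξ • a x ξ v ∂torusMeasure n)

variable {a : (Fin n → ℤ) → UnitAddTorus (Fin n) → (Lp ℂ 2 ν →L[ℂ] Lp ℂ 2 ν)}

theorem discretePDO_eq_sum (ha : ∀ x v, Integrable (fun ξ => a x ξ v) (torusMeasure n))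
    (f : (Fin n → ℤ) → Lp ℂ 2 ν) (S : Finset (Fin n → ℤ)) (hS : ∀ y ∉ S, f y = 0)
    (x : Fin n → ℤ) :
    discretePDO a f x =
      ∑ y ∈ S, ∫ ξ, mFourier (x - y) ξ • a x ξ (f y) ∂torusMeasure n := by
  rw [← integral_finsetSum _ fun y _ => (ha x (f y)).continuousMap_smul (mFourier (x - y))]
  refine integral_congr_ae (.of_forall fun ξ => ?_)
  simp only [discreteFourier]
  rw [tsum_eq_sum (s := S) (fun y hy => by rw [hS y hy, smul_zero]), map_sum, Finset.smul_sum]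
  refine Finset.sum_congr rfl fun y _ => ?_
  rw [map_smul, smul_smul, ← mFourier_add, sub_eq_add_neg]

variable {p q : ℝ≥0∞} [Fact (1 ≤ p)] {s : ℝ}

theorem DiscretePDOIsSNuclear.exists_symbolCoefficients (hs : 0 < s) (hp : p ≠ ∞)
    [p.HolderConjugate q]
    (ha : ∀ x v, Integrable (fun ξ => a x ξ v) (torusMeasure n))
    (hnuc : DiscretePDOIsSNuclear s p a) :
    ∃ (g : ℕ → DiscreteLp n ν q) (h : ℕ → DiscreteLp n ν p),
      Summable (fun k => ‖h k‖ ^ s * ‖g k‖ ^ s) ∧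
      SymbolCoefficients a (fun k => g k) (fun k => h k) := by
  obtain ⟨T, hT, φ, h, hsum, hφ⟩ := hnuc
  choose g hg hgφ using fun k => exists_discreteLp_of_dual (q := q) hp (φ k)
  have : Fact (1 ≤ q) := ⟨ENNReal.HolderConjugate.one_le q p⟩
  refine ⟨g, h, ?_, fun x y v => ?_⟩
  · refine hsum.of_nonneg_of_le (fun k => by positivity) fun k => ?_
    rw [mul_comm]
    gcongr
    exact hg k
  -- Applying the nuclear series to a vector supported at `y` and evaluating at `x` isolates one
  -- matrix entry.
  · have hev := (hφ (lp.single p y v)).mapL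
      (lp.evalCLM ℂ (fun _ : Fin n → ℤ => Lp ℂ 2 ν) p x)
    have h1 : ∀ z ∉ ({y} : Finset (Fin n → ℤ)),
        (lp.single p y v : DiscreteLp n ν p) z = 0 := fun z hz =>
      lp.single_apply_ne (E := fun _ => Lp ℂ 2 ν) p y v (by simpa using hz)
    have hTx : lp.evalCLM ℂ (fun _ : Fin n → ℤ => Lp ℂ 2 ν) p x (T (lp.single p y v)) =
        ∫ ξ, mFourier (x - y) ξ • a x ξ v ∂torusMeasure n := by
      refine (hT (lp.single p y v) ?_ x).trans ?_
      · refine (Set.finite_singleton y).subset fun z hz => ?_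
        by_contra hzy
        exact hz (h1 z (by simpa using hzy))
      · rw [discretePDO_eq_sum ha _ {y} h1, Finset.sum_singleton, lp.single_apply_self]
    rw [hTx] at hev
    refine hev.congr_fun fun k => ?_
    rw [tensorApply_eq, ← hgφ]
    rfl

theorem SymbolCoefficients.discretePDOIsSNuclear (hs₀ : 0 < s) (hs₁ : s ≤ 1)
    [Fact (1 ≤ q)] [q.HolderConjugate p]
    (ha : ∀ x v, Integrable (fun ξ => a x ξ v) (torusMeasure n))
    {g : ℕ → DiscreteLp n ν q} {h : ℕ → DiscreteLp n ν p}
    (hsum : Summable (fun k => ‖h k‖ ^ s * ‖g k‖ ^ s))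
    (hc : SymbolCoefficients a (fun k => g k) (fun k => h k)) :
    DiscretePDOIsSNuclear s p a := by
  have hsum1 := summable_mul_of_summable_rpow hs₀ hs₁ (fun k => norm_nonneg (h k))
    (fun k => norm_nonneg (g k)) hsum
  let φ : ℕ → DiscreteLp n ν p →L[ℂ] ℂ := fun k => discreteLpFunctional ν (g k)
  have hφn : ∀ k, ‖φ k‖ ≤ ‖g k‖ := fun k => norm_discreteLpFunctional_le (g k)
  have hT : Summable fun k => (φ k).smulRight (h k) := by
    refine Summable.of_norm_bounded hsum1 fun k => ?_
    rw [ContinuousLinearMap.norm_smulRight_apply, mul_comm]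
    gcongr
    exact hφn k
  have hTf : ∀ f, HasSum (fun k => φ k f • h k) ((∑' k, (φ k).smulRight (h k)) f) := fun f =>
    hT.hasSum.mapL (ContinuousLinearMap.apply ℂ (DiscreteLp n ν p) f)
  refine ⟨∑' k, (φ k).smulRight (h k), fun f hf x => ?_, φ, h, ?_, hTf⟩
  · have hev := (hTf f).mapL (lp.evalCLM ℂ (fun _ : Fin n → ℤ => Lp ℂ 2 ν) p x)
    have h0 : ∀ y ∉ hf.toFinset, f y = 0 := fun y hy => by simpa using hy
    rw [discretePDO_eq_sum ha f hf.toFinset h0]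
    -- For finitely supported `f`, the nuclear series at `x` is a finite sum over `y` of the entry
    -- series.
    refine hev.unique ((hasSum_sum fun y _ => hc x y (f y)).congr_fun fun k => ?_)
    have : φ k f = ∑ y ∈ hf.toFinset, l2Pairing ν (g k y) (f y) :=
      (discreteLpFunctional_apply (g k) f).trans
        (tsum_eq_sum fun y hy => by rw [h0 y hy, map_zero])
    simp only [tensorApply_eq]
    rw [← Finset.sum_smul, ← this]
    rfl
  · refine hsum.of_nonneg_of_le (fun k => by positivity) fun k => ?_
    rw [mul_comm]
    gcongr
    exact hφn k

theorem discreteFourierDual_twistedReflection_mFourier (g : (Fin n → ℤ) → Lp ℂ 2 ν)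
    (x y : Fin n → ℤ) :
    discreteFourierDual g (twistedReflection x (mFourier (x - y))) = g y := by
  rw [discreteFourierDual, tsum_eq_single y]
  · rw [mFourierCoeff_twistedReflection, mFourierCoeff_mFourier, if_pos rfl, one_smul]
  · intro z hz
    rw [mFourierCoeff_twistedReflection, mFourierCoeff_mFourier, if_neg (by simpa using hz),
      zero_smul]

theorem SymbolExpansion.symbolCoefficients {g h : ℕ → (Fin n → ℤ) → Lp ℂ 2 ν}
    (he : SymbolExpansion a g h) : SymbolCoefficients a g h := fun x y v => by
  have := he x v (mFourier (x - y)) (isWiener_mFourier _)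
  simpa only [discreteFourierDual_twistedReflection_mFourier] using this

/-- Boundedness of `g` suffices, since the coefficients of `φ` are absolutely summable. -/
theorem IsWiener.hasSum_discreteFourierDual {φ : C(UnitAddTorus (Fin n), ℂ)} (hφ : IsWiener φ)
    (hq : q ≠ 0) (g : DiscreteLp n ν q) (x : Fin n → ℤ) :
    HasSum (fun y => mFourierCoeff φ (x - y) • g y)
      (discreteFourierDual g (twistedReflection x φ)) := by
  have hs : Summable fun y => mFourierCoeff φ (x - y) • g y := by
    refine Summable.of_norm_bounded
      (((Equiv.subLeft x).summable_iff.mpr hφ).mul_right ‖g‖) fun y => ?_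
    rw [norm_smul]
    exact mul_le_mul_of_nonneg_left (lp.norm_apply_le_norm hq g y) (norm_nonneg _)
  convert! hs.hasSum using 1
  simp only [discreteFourierDual, mFourierCoeff_twistedReflection]

theorem SymbolCoefficients.symbolExpansion (hq : q ≠ 0)
    (ha : ∀ x v, Integrable (fun ξ => a x ξ v) (torusMeasure n))
    {g : ℕ → DiscreteLp n ν q} {h : ℕ → DiscreteLp n ν p}
    (hsum : Summable (fun k => ‖h k‖ * ‖g k‖))
    (hc : SymbolCoefficients a (fun k => g k) (fun k => h k)) :
    SymbolExpansion a (fun k => g k) (fun k => h k) := fun x v φ hφ => by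
  have hp : p ≠ 0 := (zero_lt_one.trans_le (Fact.out : 1 ≤ p)).ne'
  have hx := (Equiv.subLeft x).hasSum_iff.mpr (hφ.hasSum_integral_smul (ha x v))
  -- The double family is dominated by `|φ̂(x - y)| ‖hₖ‖ ‖gₖ‖ ‖v‖`. Summing first over `k` gives the
  -- Parseval series of the integral; summing first over `y` gives the terms of the expansion.
  set F : (Fin n → ℤ) × ℕ → Lp ℂ 2 ν := fun z =>
    mFourierCoeff φ (x - z.1) • tensorApply (h z.2 x) (g z.2 z.1) v with hF
  have hFs : Summable F := by
    have h0 : ∀ k, 0 ≤ ‖h k‖ * ‖g k‖ * ‖v‖ := fun k =>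
      mul_nonneg (mul_nonneg (norm_nonneg _) (lp.norm_nonneg' _)) (norm_nonneg _)
    refine Summable.of_norm_bounded (((Equiv.subLeft x).summable_iff.mpr hφ).mul_of_nonneg
      (hsum.mul_right ‖v‖) (fun _ => norm_nonneg _) h0) fun z => ?_
    rw [hF, norm_smul]
    refine mul_le_mul_of_nonneg_left ((norm_tensorApply_le _ _ _).trans ?_) (norm_nonneg _)
    gcongr
    · exact lp.norm_apply_le_norm hp (h z.2) x
    · exact lp.norm_apply_le_norm hq (g z.2) z.1
  have h1 := hFs.hasSum.prod_fiberwise fun y => (hc x y v).const_smul (mFourierCoeff φ (x - y))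
  have h2 : HasSum F (∫ ξ, φ ξ • a x ξ v ∂torusMeasure n) := h1.unique hx ▸ hFs.hasSum
  refine HasSum.prod_fiberwise ((Equiv.prodComm _ _).hasSum_iff.mpr h2) fun k => ?_
  have := (hφ.hasSum_discreteFourierDual hq (g k) x).mapL (tensorMap (h k x) v)
  simp only [map_smul, tensorMap_apply] at this
  exact this

end Symbol

/-! ### The almost everywhere expansion -/

section PointwiseExpansion

open UnitAddTorus

variable {n : ℕ} {H : Type*} [NormedAddCommGroup H] [InnerProductSpace ℂ H]

theorem integrable_discreteFourierL2_neg (g : (Fin n → ℤ) → H) :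
    Integrable (fun ξ => discreteFourierL2 g (-ξ)) (torusMeasure n) :=
  ((Lp.memLp (discreteFourierL2 g)).integrable one_le_two).comp_neg

variable [CompleteSpace H]

/-- On a probability space the `L¹` norm is at most the `L²` norm, which Plancherel identifies with
`‖g‖`. -/
theorem integral_norm_discreteFourierL2_neg_le (g : lp (fun _ : Fin n → ℤ => H) 2) :
    ∫ ξ, ‖discreteFourierL2 (g : (Fin n → ℤ) → H) (-ξ)‖ ∂torusMeasure n ≤ ‖g‖ := by
  rw [integral_neg_eq_self fun ξ => ‖discreteFourierL2 (g : (Fin n → ℤ) → H) ξ‖,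
    ← norm_discreteFourierL2 g, Lp.norm_def]
  have hm := Lp.memLp (discreteFourierL2 (g : (Fin n → ℤ) → H))
  rw [integral_norm_eq_lintegral_enorm hm.1, ← eLpNorm_one_eq_lintegral_enorm]
  exact ENNReal.toReal_mono hm.eLpNorm_ne_top
    (eLpNorm_le_eLpNorm_of_exponent_le one_le_two hm.1)

theorem integral_mFourier_smul_discreteFourierL2_neg (g : lp (fun _ : Fin n → ℤ => H) 2)
    (y : Fin n → ℤ) :
    ∫ ξ, mFourier (-y) ξ • discreteFourierL2 (g : (Fin n → ℤ) → H) (-ξ) ∂torusMeasure n =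
      g y := by
  rw [← integral_mFourier_smul_discreteFourierL2 g y,
    ← integral_neg_eq_self fun ξ =>
      mFourier y ξ • discreteFourierL2 (g : (Fin n → ℤ) → H) ξ]
  simp only [mFourier_apply_neg]

variable {Y : Type*} [MeasurableSpace Y] {ν : Measure Y}
  {a : (Fin n → ℤ) → UnitAddTorus (Fin n) → (Lp ℂ 2 ν →L[ℂ] Lp ℂ 2 ν)}
  {g : ℕ → DiscreteLp n ν 2} {h : ℕ → (Fin n → ℤ) → Lp ℂ 2 ν} {M : ℕ → ℝ}

/-- The `k`-th summand `e^{-2πi x·ξ} (hₖ(x) ⊗ ℱgₖ(-ξ)) v` of the symbol expansion. -/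
noncomputable def symbolTerm (u w v : Lp ℂ 2 ν) (x : Fin n → ℤ) (ξ : UnitAddTorus (Fin n)) :
    Lp ℂ 2 ν :=
  mFourier (-x) ξ • tensorApply w u v

theorem norm_symbolTerm_le (u w v : Lp ℂ 2 ν) (x : Fin n → ℤ) (ξ : UnitAddTorus (Fin n)) :
    ‖symbolTerm u w v x ξ‖ ≤ ‖w‖ * ‖u‖ * ‖v‖ := by
  rw [symbolTerm, norm_smul, norm_mFourier_apply, one_mul]
  exact norm_tensorApply_le w u v

theorem integrable_symbolTerm (g : (Fin n → ℤ) → Lp ℂ 2 ν) (w v : Lp ℂ 2 ν) (x : Fin n → ℤ) :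
    Integrable (fun ξ => symbolTerm (discreteFourierL2 g (-ξ)) w v x ξ) (torusMeasure n) := by
  have := ((tensorMap w v).integrable_comp
    (integrable_discreteFourierL2_neg g)).continuousMap_smul (mFourier (-x))
  simpa only [symbolTerm, tensorMap_apply] using this

theorem integral_mFourier_smul_symbolTerm (g : DiscreteLp n ν 2) (w v : Lp ℂ 2 ν)
    (x y : Fin n → ℤ) :
    ∫ ξ, mFourier (x - y) ξ •
      symbolTerm (discreteFourierL2 (g : (Fin n → ℤ) → Lp ℂ 2 ν) (-ξ)) w v x ξ ∂torusMeasure n =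
      tensorApply w (g y) v := by
  rw [← tensorMap_apply, ← integral_mFourier_smul_discreteFourierL2_neg g y,
    ← ContinuousLinearMap.integral_comp_comm _
      ((integrable_discreteFourierL2_neg _).continuousMap_smul _)]
  refine integral_congr_ae (.of_forall fun ξ => ?_)
  simp only [symbolTerm, map_smul, tensorMap_apply]
  rw [smul_smul, ← mFourier_add]
  congr 2
  congr 1
  abel

/-- The bound `M k` is uniform in `x`; in the application it is the `ℓᵖ` norm of `h k`. -/
theorem summable_integral_norm_symbolTerm (hM : ∀ k x, ‖h k x‖ ≤ M k)
    (hsum : Summable fun k => M k * ‖g k‖) (x : Fin n → ℤ) (v : Lp ℂ 2 ν) :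
    Summable fun k => ∫ ξ,
      ‖symbolTerm (discreteFourierL2 (g k : (Fin n → ℤ) → Lp ℂ 2 ν) (-ξ)) (h k x) v x ξ‖
        ∂torusMeasure n := by
  refine (hsum.mul_right ‖v‖).of_nonneg_of_le
    (fun k => integral_nonneg fun ξ => norm_nonneg _) fun k => ?_
  have hF := integrable_discreteFourierL2_neg (g k : (Fin n → ℤ) → Lp ℂ 2 ν)
  have hM0 : 0 ≤ M k := (norm_nonneg _).trans (hM k x)
  calc ∫ ξ, ‖symbolTerm (discreteFourierL2 (g k : (Fin n → ℤ) → Lp ℂ 2 ν) (-ξ)) (h k x) v x ξ‖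
        ∂torusMeasure n
      ≤ ∫ ξ, M k * ‖discreteFourierL2 (g k : (Fin n → ℤ) → Lp ℂ 2 ν) (-ξ)‖ * ‖v‖
          ∂torusMeasure n := by
        refine integral_mono (integrable_symbolTerm _ _ _ _).norm
          ((hF.norm.const_mul _).mul_const _) fun ξ => ?_
        refine (norm_symbolTerm_le _ _ _ _ _).trans ?_
        gcongr
        exact hM k x
    _ ≤ M k * ‖g k‖ * ‖v‖ := by
        rw [integral_mul_const, integral_const_mul]
        gcongr
        exact integral_norm_discreteFourierL2_neg_le (g k)

theorem hasSum_tensorApply_integral_tsum (hM : ∀ k x, ‖h k x‖ ≤ M k)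
    (hsum : Summable fun k => M k * ‖g k‖) (x y : Fin n → ℤ) (v : Lp ℂ 2 ν) :
    HasSum (fun k => tensorApply (h k x) (g k y) v)
      (∫ ξ, mFourier (x - y) ξ • ∑' k,
        symbolTerm (discreteFourierL2 (g k : (Fin n → ℤ) → Lp ℂ 2 ν) (-ξ)) (h k x) v x ξ
          ∂torusMeasure n) := by
  have := hasSum_integral_of_summable_integral_norm (μ := torusMeasure n)
    (F := fun k ξ => mFourier (x - y) ξ •
      symbolTerm (discreteFourierL2 (g k : (Fin n → ℤ) → Lp ℂ 2 ν) (-ξ)) (h k x) v x ξ)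
    (fun k => (integrable_symbolTerm _ _ _ _).continuousMap_smul _)
    (by simpa only [norm_smul, norm_mFourier_apply, one_mul] using
      summable_integral_norm_symbolTerm hM hsum x v)
  simp only [integral_mFourier_smul_symbolTerm] at this
  convert! this using 1
  refine integral_congr_ae (.of_forall fun ξ => ?_)
  exact (tsum_const_smul'' _).symm

theorem SymbolExpansionAE.symbolCoefficients (hM : ∀ k x, ‖h k x‖ ≤ M k)
    (hsum : Summable fun k => M k * ‖g k‖)
    (he : SymbolExpansionAE a (fun k => g k) h) :
    SymbolCoefficients a (fun k => g k) h := fun x y v => by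
  convert! hasSum_tensorApply_integral_tsum hM hsum x y v using 1
  refine integral_congr_ae ?_
  filter_upwards [he] with ξ hξ
  exact congrArg _ (hξ x v).tsum_eq.symm

/-- The operator `v ↦ e^{-2πi x·ξ} (hₖ(x) ⊗ ℱgₖ(-ξ)) v`. -/
noncomputable def symbolTermCLM (u w : Lp ℂ 2 ν) (x : Fin n → ℤ) (ξ : UnitAddTorus (Fin n)) :
    Lp ℂ 2 ν →L[ℂ] Lp ℂ 2 ν :=
  mFourier (-x) ξ • (l2Pairing ν u).smulRight w

theorem symbolTermCLM_apply (u w v : Lp ℂ 2 ν) (x : Fin n → ℤ) (ξ : UnitAddTorus (Fin n)) :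
    symbolTermCLM u w x ξ v = symbolTerm u w v x ξ := by
  rw [symbolTerm, tensorApply_eq]
  rfl

theorem norm_symbolTermCLM_le (u w : Lp ℂ 2 ν) (x : Fin n → ℤ) (ξ : UnitAddTorus (Fin n)) :
    ‖symbolTermCLM u w x ξ‖ ≤ ‖w‖ * ‖u‖ :=
  ContinuousLinearMap.opNorm_le_bound _ (by positivity) fun v => by
    rw [symbolTermCLM_apply]
    exact norm_symbolTerm_le u w v x ξ

/-- Both sides are integrable in `ξ` with the same Fourier coefficients. The exceptional null set
still depends on `x` and `v`. -/
theorem SymbolCoefficients.ae_eq_tsum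
    (ha : ∀ x v, Integrable (fun ξ => a x ξ v) (torusMeasure n))
    (hM : ∀ k x, ‖h k x‖ ≤ M k) (hsum : Summable fun k => M k * ‖g k‖)
    (hc : SymbolCoefficients a (fun k => g k) h) (x : Fin n → ℤ) (v : Lp ℂ 2 ν) :
    ∀ᵐ ξ ∂torusMeasure n, a x ξ v = ∑' k,
      symbolTerm (discreteFourierL2 (g k : (Fin n → ℤ) → Lp ℂ 2 ν) (-ξ)) (h k x) v x ξ := by
  have hb := integrable_tsum_of_summable_integral_norm
    (fun k => integrable_symbolTerm (g k : (Fin n → ℤ) → Lp ℂ 2 ν) (h k x) v x)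
    (summable_integral_norm_symbolTerm hM hsum x v)
  have h0 := ae_eq_zero_of_integral_mFourier_smul_eq_zero ((ha x v).sub hb) fun z => by
    have h1 := hc x (x - z) v
    have h2 := hasSum_tensorApply_integral_tsum hM hsum x (x - z) v
    have h3 := h1.unique h2
    rw [sub_sub_cancel] at h3
    simp only [Pi.sub_apply, smul_sub]
    exact (integral_sub ((ha x v).continuousMap_smul _) (hb.continuousMap_smul _)).trans
      (sub_eq_zero.mpr h3)
  filter_upwards [h0] with ξ hξ
  exact sub_eq_zero.mp hξ

theorem SymbolCoefficients.symbolExpansionAE [TopologicalSpace.SeparableSpace (Lp ℂ 2 ν)]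
    (ha : ∀ x v, Integrable (fun ξ => a x ξ v) (torusMeasure n))
    (hM : ∀ k x, ‖h k x‖ ≤ M k) (hsum : Summable fun k => M k * ‖g k‖)
    (hc : SymbolCoefficients a (fun k => g k) h) :
    SymbolExpansionAE a (fun k => g k) h := by
  have hM0 : ∀ k, 0 ≤ M k := fun k => (norm_nonneg _).trans (hM k 0)
  obtain ⟨D, hDc, hD⟩ := TopologicalSpace.exists_countable_dense (Lp ℂ 2 ν)
  have h1 : ∀ᵐ ξ ∂torusMeasure n, ∀ (x : Fin n → ℤ), ∀ v ∈ D, a x ξ v = ∑' k,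
      symbolTerm (discreteFourierL2 (g k : (Fin n → ℤ) → Lp ℂ 2 ν) (-ξ)) (h k x) v x ξ :=
    ae_all_iff.mpr fun x => (ae_ball_iff hDc).mpr fun v _ => hc.ae_eq_tsum ha hM hsum x v
  -- This condition involves neither `x` nor `v`, so one null set gives convergence in operator norm
  -- for all `x`.
  have h2 : ∀ᵐ ξ ∂torusMeasure n, Summable fun k =>
      ‖M k • discreteFourierL2 (g k : (Fin n → ℤ) → Lp ℂ 2 ν) (-ξ)‖ := by
    refine ae_summable_norm_of_summable_integral_norm
      (fun k => (integrable_discreteFourierL2_neg _).smul (M k))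
      (hsum.of_nonneg_of_le (fun k => integral_nonneg fun ξ => norm_nonneg _) fun k => ?_)
    simp only [norm_smul, Real.norm_of_nonneg (hM0 k)]
    rw [integral_const_mul]
    exact mul_le_mul_of_nonneg_left (integral_norm_discreteFourierL2_neg_le (g k)) (hM0 k)
  filter_upwards [h1, h2] with ξ hξ hs x v
  have hB : Summable fun k =>
      symbolTermCLM (discreteFourierL2 (g k : (Fin n → ℤ) → Lp ℂ 2 ν) (-ξ)) (h k x) x ξ := by
    refine hs.of_norm_bounded fun k => (norm_symbolTermCLM_le _ _ _ _).trans ?_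
    rw [norm_smul, Real.norm_of_nonneg (hM0 k)]
    gcongr
    exact hM k x
  have hBv : ∀ v, HasSum (fun k =>
      symbolTerm (discreteFourierL2 (g k : (Fin n → ℤ) → Lp ℂ 2 ν) (-ξ)) (h k x) v x ξ)
      ((∑' k, symbolTermCLM (discreteFourierL2 (g k : (Fin n → ℤ) → Lp ℂ 2 ν) (-ξ))
        (h k x) x ξ) v) := fun v => by
    simpa only [ContinuousLinearMap.apply_apply, symbolTermCLM_apply] using
      hB.hasSum.mapL (ContinuousLinearMap.apply ℂ (Lp ℂ 2 ν) v)
  -- Both operators are continuous, so agreement on the countable dense set `D` extends to all of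
  -- `H`.
  have heq := Continuous.ext_on hD (a x ξ).continuous
    (∑' k, symbolTermCLM (discreteFourierL2 (g k : (Fin n → ℤ) → Lp ℂ 2 ν) (-ξ))
        (h k x) x ξ).continuous fun v hv => (hξ x v hv).trans (hBv v).tsum_eq
  rw [heq]
  exact hBv v

end PointwiseExpansion

/-! ### Assembly of the two equivalences -/

theorem theorem3p5 {n : ℕ} {Y : Type*} [MeasurableSpace Y] (ν : Measure Y)
    (s : ℝ) (hs₀ : 0 < s) (hs₁ : s ≤ 1)
    (p q : ℝ≥0∞) [Fact (1 ≤ p)] (hp : p ≠ ∞) (hpq : p.HolderConjugate q)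
    (a : (Fin n → ℤ) → UnitAddTorus (Fin n) → (Lp ℂ 2 ν →L[ℂ] Lp ℂ 2 ν))
    (ha : ∀ x v, Integrable (fun ξ => a x ξ v) (torusMeasure n)) :
    (DiscretePDOIsSNuclear s p a ↔
      ∃ (g : ℕ → DiscreteLp n ν q) (h : ℕ → DiscreteLp n ν p),
        Summable (fun k => ‖h k‖ ^ s * ‖g k‖ ^ s) ∧
        SymbolExpansion a (fun k => g k) (fun k => h k)) ∧
    (2 ≤ p → TopologicalSpace.SeparableSpace (Lp ℂ 2 ν) →
      (DiscretePDOIsSNuclear s p a ↔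
        ∃ (g : ℕ → DiscreteLp n ν q) (h : ℕ → DiscreteLp n ν p),
          Summable (fun k => ‖h k‖ ^ s * ‖g k‖ ^ s) ∧
          SymbolExpansionAE a (fun k => g k) (fun k => h k))) := by
  have hp0 : p ≠ 0 := (ENNReal.HolderConjugate.pos p q).ne'
  have hq0 : q ≠ 0 := (ENNReal.HolderConjugate.pos q p).ne'
  have : Fact (1 ≤ q) := ⟨ENNReal.HolderConjugate.one_le q p⟩
  have hsum1 : ∀ (g : ℕ → DiscreteLp n ν q) (h : ℕ → DiscreteLp n ν p),
      Summable (fun k => ‖h k‖ ^ s * ‖g k‖ ^ s) → Summable fun k => ‖h k‖ * ‖g k‖ := fun g h =>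
    summable_mul_of_summable_rpow hs₀ hs₁ (fun k => norm_nonneg (h k)) fun k => norm_nonneg (g k)
  refine ⟨⟨fun hnuc => ?_, fun ⟨g, h, hs, he⟩ =>
    he.symbolCoefficients.discretePDOIsSNuclear hs₀ hs₁ ha hs⟩, fun hp2 hsep => ?_⟩
  · obtain ⟨g, h, hs, hc⟩ := hnuc.exists_symbolCoefficients (q := q) hs₀ hp ha
    exact ⟨g, h, hs, hc.symbolExpansion hq0 ha (hsum1 g h hs)⟩
  · have hq2 : q ≤ 2 := by
      rw [← ENNReal.inv_le_inv, ← ENNReal.HolderConjugate.one_sub_inv p q]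
      calc (2 : ℝ≥0∞)⁻¹ = 1 - 2⁻¹ := ENNReal.one_sub_inv_two.symm
        _ ≤ 1 - p⁻¹ := tsub_le_tsub_left (ENNReal.inv_le_inv.mpr hp2) 1
    -- `G g` is the same function as `g`, measured in `ℓ²`, so coefficient identities and expansions
    -- transfer unchanged.
    let G : DiscreteLp n ν q → DiscreteLp n ν 2 := fun g =>
      ⟨g, (lp.memℓp g).of_exponent_ge hq2⟩
    have hM : ∀ (h : ℕ → DiscreteLp n ν p) k x, ‖h k x‖ ≤ ‖h k‖ := fun h k x =>
      lp.norm_apply_le_norm hp0 (h k) x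
    have hG : ∀ (g : ℕ → DiscreteLp n ν q) (h : ℕ → DiscreteLp n ν p),
        Summable (fun k => ‖h k‖ ^ s * ‖g k‖ ^ s) →
          Summable fun k => ‖h k‖ * ‖G (g k)‖ := fun g h hs =>
      (hsum1 g h hs).of_nonneg_of_le (fun k => by positivity) fun k =>
        mul_le_mul_of_nonneg_left (lp.norm_inclusion_le hq0 hq2 ENNReal.ofNat_ne_top (g k))
          (norm_nonneg _)
    refine ⟨fun hnuc => ?_, fun ⟨g, h, hs, he⟩ => ?_⟩
    · obtain ⟨g, h, hs, hc⟩ := hnuc.exists_symbolCoefficients (q := q) hs₀ hp ha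
      exact ⟨g, h, hs, SymbolCoefficients.symbolExpansionAE (g := fun k => G (g k)) ha (hM h)
        (hG g h hs) hc⟩
    · have hc : SymbolCoefficients a (fun k => g k) (fun k => h k) :=
        SymbolExpansionAE.symbolCoefficients (g := fun k => G (g k)) (hM h) (hG g h hs) he
      exact hc.discretePDOIsSNuclear hs₀ hs₁ ha hs
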